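/- **Setting.** Let $\Omega\subset\mathbb R^2$ be open and let $\mathcal T_h$ be a finite conforming triangulation of $\overline\Omega$ into straight closed triangles (two distinct triangles are disjoint or share exactly a common vertex or a common edge, and $\bigcup_{T\in\mathcal T_h}T=\overline\Omega$). Let $\mathcal F_h$ be the set of edges (facets) of the triangulation; $F\in\mathcal F_h$ is exterior if $F\subset\partial\Omega$ and interior otherwise. The triangulation is shape regular with constant $\sigma$: every $T$ contains a disc of some radius $r>0$ with $\operatorname{diam}T\le\sigma r$. Let $h$ be a local mesh size, i.e. numbers $h_T>0$ with $\operatorname{diam}T\le\kappa h_T$ and $h_T\le\kappa\operatorname{diam}T$ for all $T\in\mathcal T_h$ (for example $h_T=\operatorname{diam}T$, $\kappa=1$). For an integer $k\ge1$ let $\mathcal P^m(S)$ be the polynomials of total degree at most $m$ on $S$, and let $\Pi_F^{k-1}$ be the $L^2(F)$-orthogonal projection onto $\mathcal P^{k-1}(F)$ (componentwise for vector fields). On an edge $F$ of $T$ let $n$ be the unit normal pointing out of $T$, and $v^t=v-(v\cdot n)n$. The normal jump $[\![u_{\mathcal T}\cdot n]\!]$ is the sum of the two outward normal components of the one-sided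 values on an interior facet, and $u_T\cdot n$ on an exterior facet. The discrete velocity space $U_h$ consists of the pairs $u_h=(u_{\mathcal T},u_{\mathcal F})$ with * $u_{\mathcal T}\in\prod_{T\in\mathcal T_h}[\mathcal P^k(T)]^2$ and $\Pi_F^{k-1}[\![u_{\mathcal T}\cdot n]\!]=0$ for all $F\in\mathcal F_h$; * $u_{\mathcal F}\in\prod_{F\in\mathcal F_h}[\mathcal P^{k-1}(F)]^2$, $u_{\mathcal F}\cdot n=0$ on interior facets and $u_{\mathcal F}=0$ on exterior facets. On each edge $F$ of $T$ put $[\![u_h^t]\!]:=u_T^t|_F-u_F$. For $\nu>0$ and $\lambda>0$ define $$ \begin{aligned} \mathcal A(u_h,v_h):=\sum_{T\in\mathcal T_h}\Big\{&\int_T\nu\,\nabla u_{\mathcal T}:\nabla v_{\mathcal T}\,dx-\int_{\partial T}\nu\frac{\partial u_{\mathcal T}}{\partial n}\cdot\Pi_F^{k-1}[\![v_h^t]\!]\,ds-\int_{\partial T}\nu\frac{\partial v_{\mathcal T}}{\partial n}\cdot\Pi_F^{k-1}[\![u_h^t]\!]\,ds\\ &+\int_{\partial T}\nu\frac{\lambda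 k^2}{h_T}\,\Pi_F^{k-1}[\![u_h^t]\!]\cdot\Pi_F^{k-1}[\![v_h^t]\!]\,ds\Big\}, \end{aligned} $$ $$ |\!|\!|u_h|\!|\!|_1^2:=\sum_{T\in\mathcal T_h}\Big\{\|\nabla u_T\|_{L^2(T)}^2+\frac{k^2}{h_T}\big\|\Pi_F^{k-1}[\![u_h^t]\!]\big\|_{L^2(\partial T)}^2\Big\}. $$ **Lemma (Coercivity).** For all $\sigma$ and $\kappa$ there are a stabilization parameter $\lambda>0$ and a constant $c_{CO}>0$, depending only on $\sigma$ and $\kappa$ (in particular not on $h$, $k$, $\nu$ or the mesh), such that for every $\Omega$, every triangulation $\mathcal T_h$ and every mesh size $h$ as above, every $k\ge1$ and every $\nu>0$, $$\mathcal A(u_h,u_h)\;\ge\;c_{CO}\,\nu\,|\!|\!|u_h|\!|\!|_1^2\qquad\text{for all }u_h\in U_h .$$ -/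

import Mathlib

open MeasureTheory
open scoped MeasureTheory RealInnerProductSpace

noncomputable section

namespace HDG

/-- The Euclidean plane. -/
abbrev Plane : Type := EuclideanSpace ℝ (Fin 2)

/-! ### Triangulations -/

/-- A (conforming, straight) triangulation of the plane region `Ω`: a finite simplicial complex all of
whose faces are faces of triangles and whose underlying space is the closure of `Ω`.
A face is given by the finite set of its vertices. -/
structure Triangulation (Ω : Set Plane) extends Geometry.SimplicialComplex ℝ Plane where
  finite_faces : faces.Finite
  pure_faces : ∀ s ∈ faces, ∃ t ∈ faces, s ⊆ t ∧ t.card = 3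
  space_eq : toSimplicialComplex.space = closure Ω

/-- The closed triangle or segment spanned by a finite set of vertices. -/
def hull (s : Finset Plane) : Set Plane := convexHull ℝ (s : Set Plane)

/-- The elements (triangles) of the triangulation. -/
def Triangulation.elements {Ω : Set Plane} (𝒯 : Triangulation Ω) : Finset (Finset Plane) :=
  𝒯.finite_faces.toFinset.filter fun T => T.card = 3

/-- The facets (edges) of the triangulation. -/
def Triangulation.facets {Ω : Set Plane} (𝒯 : Triangulation Ω) : Finset (Finset Plane) :=
  𝒯.finite_faces.toFinset.filter fun F => F.card = 2

/-- The elements that have `F` as a facet. -/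
def Triangulation.neighbours {Ω : Set Plane} (𝒯 : Triangulation Ω) (F : Finset Plane) :
    Finset (Finset Plane) :=
  open Classical in 𝒯.elements.filter fun T => F ⊆ T

/-- An exterior facet is one that lies on the boundary of the domain; the others are interior. -/
def IsExterior (Ω : Set Plane) (F : Finset Plane) : Prop := hull F ⊆ frontier Ω

/-- The three facets that make up the boundary of the triangle `T`. -/
def edges (T : Finset Plane) : Finset (Finset Plane) := T.powersetCard 2

/-- Shape regularity with constant `σ`: every triangle `T` contains a disc of radius `r > 0`
with `diam T ≤ σ r`. -/
def Triangulation.ShapeRegular {Ω : Set Plane} (𝒯 : Triangulation Ω) (σ : ℝ) : Prop :=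
  ∀ T ∈ 𝒯.elements, ∃ x : Plane, ∃ r : ℝ, 0 < r ∧ Metric.closedBall x r ⊆ hull T ∧
    Metric.diam (hull T) ≤ σ * r

/-- `h` is a characteristic (local) mesh size: `h T` is positive and comparable to the diameter
of the triangle `T`, up to the factor `κ`. -/
def Triangulation.IsMeshSize {Ω : Set Plane} (𝒯 : Triangulation Ω) (κ : ℝ)
    (h : Finset Plane → ℝ) : Prop :=
  ∀ T ∈ 𝒯.elements, 0 < h T ∧ Metric.diam (hull T) ≤ κ * h T ∧ h T ≤ κ * Metric.diam (hull T)

/-- The unit normal on the edge `F` of the triangle `T` pointing out of `T`: the normalized component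
orthogonal to `F` of the vector from the vertex of `T` opposite to `F` to the midpoint of `F`. -/
def outwardNormal (T F : Finset Plane) : Plane :=
  open Classical in
  let v : Plane := (vectorSpan ℝ (F : Set Plane))ᗮ.starProjection
    ((1 / 2 : ℝ) • (∑ a ∈ F, a) - ∑ c ∈ T \ F, c)
  ‖v‖⁻¹ • v

/-- The tangential part `v - (v · n) n`. -/
def tangential (n v : Plane) : Plane := v - ⟪v, n⟫ • n

/-! ### Polynomials and the facet projection -/

/-- The restriction of `f` to `S` is a polynomial of total degree at most `m`. -/
def IsPolyOn (m : ℕ) (S : Set Plane) (f : Plane → ℝ) : Prop :=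
  ∃ p : MvPolynomial (Fin 2) ℝ, p.totalDegree ≤ m ∧
    ∀ x ∈ S, f x = MvPolynomial.eval (fun i => x i) p

/-- The restriction of the vector field `f` to `S` lies in `[𝒫^m(S)]²`. -/
def IsVecPolyOn (m : ℕ) (S : Set Plane) (f : Plane → Plane) : Prop :=
  ∀ i, IsPolyOn m S fun x => f x i

/-- The integral over the facet `F` with respect to arc length. -/
def facetIntegral (F : Finset Plane) (f : Plane → ℝ) : ℝ :=
  ∫ x in hull F, f x ∂(Measure.hausdorffMeasure 1)

/-- `p` is an `L²(F)`-projection of `w` into `𝒫^m(F)`. -/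
def IsFacetProj (m : ℕ) (F : Finset Plane) (w p : Plane → ℝ) : Prop :=
  IsPolyOn m (hull F) p ∧ ∀ v : Plane → ℝ, IsPolyOn m (hull F) v →
    facetIntegral F (fun x => p x * v x) = facetIntegral F fun x => w x * v x

open Classical in
/-- The `L²(F)`-projection of `w` into `𝒫^m(F)`; only its values on `F` are meaningful.
It exists for every `w` that is continuous on the facet, see `facetProj_spec`. -/
def facetProj (m : ℕ) (F : Finset Plane) (w : Plane → ℝ) : Plane → ℝ :=
  if h : ∃ p, IsFacetProj m F w p then h.choose else 0

/-- The arc length measure on a facet is finite. -/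
theorem isFiniteMeasure_facet {F : Finset Plane} (hF : F.card = 2) :
    IsFiniteMeasure ((Measure.hausdorffMeasure 1 : Measure Plane).restrict (hull F)) := by
  classical
  obtain ⟨a, b, -, rfl⟩ := Finset.card_eq_two.1 hF
  refine ⟨?_⟩
  rw [Measure.restrict_apply_univ, hull, Finset.coe_pair, convexHull_pair, hausdorffMeasure_segment]
  exact edist_lt_top a b

/-- The `L²(F)`-projection of a continuous function exists. -/
theorem facetProj_spec (m : ℕ) {F : Finset Plane} (hF : F.card = 2) {w : Plane → ℝ}
    (hw : ContinuousOn w (hull F)) : IsFacetProj m F w (facetProj m F w) := by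
  suffices h : ∃ p, IsFacetProj m F w p by
    rw [facetProj, dif_pos h]; exact h.choose_spec
  have := isFiniteMeasure_facet hF
  set μ : Measure Plane := (Measure.hausdorffMeasure 1 : Measure Plane).restrict (hull F) with hμ
  have hcpt : IsCompact (hull F) := F.finite_toSet.isCompact_convexHull ℝ
  have hms : MeasurableSet (hull F) := hcpt.isClosed.measurableSet
  have hL : ∀ g : Plane → ℝ, ContinuousOn g (hull F) → MemLp g 2 μ := fun g hg => by
    obtain ⟨C, hC⟩ := hcpt.exists_bound_of_continuousOn hg
    exact MemLp.of_bound (hg.aestronglyMeasurable hms) C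
      ((ae_restrict_iff' hms).2 (Filter.Eventually.of_forall hC))
  let ev : MvPolynomial (Fin 2) ℝ → Plane → ℝ := fun p x => MvPolynomial.eval (fun i => x i) p
  have hev : ∀ p, MemLp (ev p) 2 μ := fun p => hL _ <| Continuous.continuousOn <|
    (MvPolynomial.continuous_eval p).comp (by fun_prop)
  let L : MvPolynomial.restrictTotalDegree (Fin 2) ℝ m →ₗ[ℝ] Lp ℝ 2 μ :=
    { toFun := fun p => (hev p.1).toLp _
      map_add' := fun p q => by
        rw [← MemLp.toLp_add]; congr 1; ext x; simp [ev]
      map_smul' := fun c p => by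
        rw [RingHom.id_apply, ← MemLp.toLp_const_smul]; congr 1; ext x
        simp [ev, MvPolynomial.smul_eval] }
  have hint : ∀ f g : Plane → ℝ, (hf : MemLp f 2 μ) → (hg : MemLp g 2 μ) →
      ⟪hf.toLp f, hg.toLp g⟫ = facetIntegral F fun x => f x * g x := fun f g hf hg => by
    rw [L2.inner_def, facetIntegral]
    refine integral_congr_ae ?_
    filter_upwards [hf.coeFn_toLp, hg.coeFn_toLp] with x h1 h2
    rw [h1, h2]; simp [mul_comm]
  obtain ⟨p, hp⟩ : (LinearMap.range L).starProjection ((hL w hw).toLp w) ∈ LinearMap.range L :=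
    Submodule.starProjection_apply_mem _ _
  refine ⟨ev p.1, ⟨p.1, (MvPolynomial.mem_restrictTotalDegree _ _ _).1 p.2, fun _ _ => rfl⟩, ?_⟩
  rintro v ⟨q, hq, hv⟩
  have hcong : ∀ f : Plane → ℝ, (facetIntegral F fun x => f x * v x) =
      facetIntegral F fun x => f x * ev q x := fun f =>
    setIntegral_congr_fun hms fun x hx => by simp only [hv x hx, ev]
  rw [hcong, hcong, ← hint _ _ (hev p.1) (hev q), ← hint _ _ (hL w hw) (hev q)]
  have h1 : (hev p.1).toLp _ = (LinearMap.range L).starProjection ((hL w hw).toLp w) := hp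
  have h2 := Submodule.starProjection_inner_eq_zero (K := LinearMap.range L) ((hL w hw).toLp w)
    ((hev q).toLp _) ⟨⟨q, (MvPolynomial.mem_restrictTotalDegree _ _ _).2 hq⟩, rfl⟩
  rw [inner_sub_left, sub_eq_zero] at h2
  rw [h1, h2]

/-- The `L²(F)`-projection into `[𝒫^m(F)]²`, which acts componentwise. -/
def facetProjVec (m : ℕ) (F : Finset Plane) (w : Plane → Plane) : Plane → Plane :=
  fun x => WithLp.toLp 2 fun i => facetProj m F (fun y => w y i) x

/-! ### The discrete velocity space -/

/-- A pair of an element unknown `elt` (a field on each triangle) and a facet unknown `fct`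
(a field on each edge). -/
structure Velocity where
  elt : Finset Plane → Plane → Plane
  fct : Finset Plane → Plane → Plane

/-- The jump `⟦u_𝒯 · n⟧` across `F`: on an interior facet, the sum of the two one-sided outward
normal components; on an exterior facet, the normal component itself. -/
def normalJump {Ω : Set Plane} (𝒯 : Triangulation Ω) (u : Velocity) (F : Finset Plane)
    (x : Plane) : ℝ :=
  ∑ T ∈ 𝒯.neighbours F, ⟪u.elt T x, outwardNormal T F⟫

/-- The element-sided jump `u_T^t - u_F` of the tangential part, seen from `T`. -/
def tangentialJump (u : Velocity) (T F : Finset Plane) (x : Plane) : Plane :=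
  tangential (outwardNormal T F) (u.elt T x) - u.fct F x

/-- Membership in the discrete velocity space of order `k`: element-wise polynomials of degree at
most `k` with relaxed normal continuity, paired with facet-wise tangential polynomials of degree at
most `k - 1` that vanish on the boundary of the domain. -/
structure IsDiscreteVelocity {Ω : Set Plane} (𝒯 : Triangulation Ω) (k : ℕ) (u : Velocity) :
    Prop where
  elt_poly : ∀ T ∈ 𝒯.elements, IsVecPolyOn k (hull T) (u.elt T)
  relaxed_normal : ∀ F ∈ 𝒯.facets, ∀ x ∈ hull F, facetProj (k - 1) F (normalJump 𝒯 u F) x = 0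
  fct_poly : ∀ F ∈ 𝒯.facets, IsVecPolyOn (k - 1) (hull F) (u.fct F)
  fct_tangential : ∀ F ∈ 𝒯.facets, ¬ IsExterior Ω F → ∀ T ∈ 𝒯.neighbours F, ∀ x ∈ hull F,
    ⟪u.fct F x, outwardNormal T F⟫ = 0
  fct_boundary : ∀ F ∈ 𝒯.facets, IsExterior Ω F → ∀ x ∈ hull F, u.fct F x = 0

/-! ### The bilinear form and the discrete norm -/

/-- The Jacobian at `x` of the part of `u` on the triangle `T`. -/
def eltDeriv (u : Velocity) (T : Finset Plane) (x : Plane) : Plane →L[ℝ] Plane :=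
  fderivWithin ℝ (u.elt T) (hull T) x

/-- The Frobenius product `∇u : ∇v` on `T`. -/
def gradDot (u v : Velocity) (T : Finset Plane) (x : Plane) : ℝ :=
  ∑ j : Fin 2, ⟪eltDeriv u T x (EuclideanSpace.single j 1),
    eltDeriv v T x (EuclideanSpace.single j 1)⟫

/-- The outward normal derivative `∂u/∂n` on the edge `F` of `T`. -/
def normalDeriv (u : Velocity) (T F : Finset Plane) (x : Plane) : Plane :=
  eltDeriv u T x (outwardNormal T F)

/-- The projected tangential jump on the edge `F` of `T`. -/
def projJump (k : ℕ) (u : Velocity) (T F : Finset Plane) : Plane → Plane :=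
  facetProjVec (k - 1) F (tangentialJump u T F)

/-- The viscous bilinear form with viscosity `ν`, stabilization parameter `lam`, order `k` and
mesh size `h`. -/
def bilinA {Ω : Set Plane} (𝒯 : Triangulation Ω) (ν lam : ℝ) (k : ℕ) (h : Finset Plane → ℝ)
    (u v : Velocity) : ℝ :=
  ∑ T ∈ 𝒯.elements,
    ((∫ x in hull T, ν * gradDot u v T x)
      - (∑ F ∈ edges T, facetIntegral F fun x => ν * ⟪normalDeriv u T F x, projJump k v T F x⟫)
      - (∑ F ∈ edges T, facetIntegral F fun x => ν * ⟪normalDeriv v T F x, projJump k u T F x⟫)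
      + ∑ F ∈ edges T, facetIntegral F fun x =>
          ν * (lam * (k : ℝ) ^ 2 / h T) * ⟪projJump k u T F x, projJump k v T F x⟫)

/-- The discrete energy norm. -/
def energyNorm {Ω : Set Plane} (𝒯 : Triangulation Ω) (k : ℕ) (h : Finset Plane → ℝ)
    (u : Velocity) : ℝ :=
  √(∑ T ∈ 𝒯.elements,
    ((∫ x in hull T, gradDot u u T x)
      + (k : ℝ) ^ 2 / h T * ∑ F ∈ edges T, facetIntegral F fun x => ‖projJump k u T F x‖ ^ 2))

end HDG

end

/-! ### A weighted endpoint inequality for univariate polynomials -/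

/-! The estimate is local: it holds triangle by triangle and is then summed. With `v = u` the two
consistency terms coincide, so on one triangle the form is `ν` times the gradient energy, minus
twice the pairing of the normal derivative with the projected jump `J`, plus `λ k² / h_T` times the
squared norm of `J`. Young's inequality absorbs the pairing, provided the normal derivative on an
edge is controlled by the gradient in the interior: `‖∂u/∂n‖²_F ≤ C (k² / h_T) ‖∇u‖²_T`, with `C`
depending only on `σ` and `κ`.

This discrete trace inequality with the sharp power `k²` is the core. In Duffy coordinates a
triangle is swept by segments from the points of an edge to the opposite vertex, with Jacobian
proportional to `1 - y`; see `abs_cross_mul_integral_le`. It therefore suffices to prove `p(0)² ≤ 4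
(m + 1)² ∫₀¹ (1 - y) p(y)² dy` for univariate `p` of degree at most `m`, which is
`Polynomial.eval_zero_sq_le_integral`. The weighted square is a nonnegative polynomial, so its
antiderivative is monotone on `[0, 1]`, and Markov's endpoint inequality for that antiderivative
bounds its derivative at `0`. Shape regularity enters only through the ratio of edge length to area,
in `facetIntegral_sq_le_of_shapeRegular`. -/

theorem Polynomial.exists_derivative_eq {K : Type*} [Field K] [CharZero K] (p : Polynomial K) :
    ∃ P : Polynomial K, P.natDegree ≤ p.natDegree + 1 ∧ Polynomial.derivative P = p := by
  refine ⟨∑ i ∈ p.support, Polynomial.monomial (i + 1) (p.coeff i / (i + 1)), ?_, ?_⟩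
  · refine Polynomial.natDegree_sum_le_of_forall_le _ _ fun i hi => ?_
    refine (Polynomial.natDegree_monomial_le _).trans ?_
    have := Polynomial.le_natDegree_of_mem_supp i hi
    omega
  · rw [Polynomial.derivative_sum]
    conv_rhs => rw [p.as_sum_support]
    refine Finset.sum_congr rfl fun i _ => ?_
    have : (i : K) + 1 ≠ 0 := by exact_mod_cast Nat.succ_ne_zero i
    rw [Polynomial.derivative_monomial]
    push_cast
    rw [div_mul_cancel₀ _ this]

/-- Markov's inequality for the derivative at an endpoint. -/
theorem Polynomial.eval_one_derivative_le_sq {n : ℕ} {P : Polynomial ℝ} (hP : P.natDegree ≤ n)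
    (hb : ∀ x ∈ Set.Icc (-1 : ℝ) 1, |P.eval x| ≤ 1) :
    (Polynomial.derivative P).eval 1 ≤ (n : ℝ) ^ 2 := by
  -- The Chebyshev polynomial is extremal at the endpoint, and `T_n'(1) = n U_{n-1}(1) = n²`.
  have h := Polynomial.Chebyshev.eval_iterate_derivative_le_of_forall_abs_le_one (k := 1)
    (le_refl (1 : ℝ)) (Polynomial.degree_le_of_natDegree_le hP) hb
  simp only [Function.iterate_one, Polynomial.Chebyshev.T_derivative_eq_U, Polynomial.eval_mul,
    Polynomial.Chebyshev.U_eval_one] at h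
  simpa [sq] using h

/-- A polynomial that is nonnegative on `[0, 1]` is bounded at `0` by its integral. -/
theorem Polynomial.eval_zero_le_integral {n : ℕ} {w : Polynomial ℝ} (hn : w.natDegree ≤ n)
    (hw : ∀ x ∈ Set.Icc (0 : ℝ) 1, 0 ≤ w.eval x) :
    w.eval 0 ≤ ((n : ℝ) + 1) ^ 2 * ∫ y in (0 : ℝ)..1, w.eval y := by
  set I : ℝ := ∫ y in (0 : ℝ)..1, w.eval y with hI
  obtain ⟨P, hPd, hP⟩ := w.exists_derivative_eq
  have hii : ∀ a b : ℝ, IntervalIntegrable (fun y => w.eval y) volume a b := fun a b =>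
    w.continuous.intervalIntegrable a b
  have hint : ∀ a b : ℝ, ∫ y in a..b, w.eval y = P.eval b - P.eval a := fun a b =>
    intervalIntegral.integral_eq_sub_of_hasDerivAt
      (fun x _ => by simpa [hP] using P.hasDerivAt x) (hii a b)
  have hI0 : 0 ≤ I := intervalIntegral.integral_nonneg zero_le_one hw
  -- The normalization divides by the integral, which vanishes for `w = 0`. A positive upper bound
  -- `J` is used instead, and `J` tends to `I` at the end.
  have key : ∀ J : ℝ, 0 < J → I ≤ J → w.eval 0 ≤ ((n : ℝ) + 1) ^ 2 * J := by
    intro J hJ hIJ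
    -- The antiderivative is transported to `[-1, 1]` with `0` sent to the endpoint `1`. It grows
    -- from `0` to at most `J`, so `Q` stays in `[-1, 1]`; the factors `2 / J` and `1 / 2` give
    -- `Q'(1) = w(0) / J`.
    let Q : Polynomial ℝ := 1 - Polynomial.C (2 / J) *
      (P - Polynomial.C (P.eval 0)).comp (Polynomial.C (1 / 2) * (1 - Polynomial.X))
    have hQe : ∀ x, Q.eval x = 1 - 2 / J * (P.eval ((1 - x) / 2) - P.eval 0) := by
      intro x
      have : 1 / 2 * (1 - x) = (1 - x) / 2 := by ring
      simp only [Q, Polynomial.eval_sub, Polynomial.eval_one, Polynomial.eval_mul,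
        Polynomial.eval_C, Polynomial.eval_comp, Polynomial.eval_X, this]
    have hQd : Q.natDegree ≤ n + 1 := by
      have h1 : (Polynomial.C (1 / 2 : ℝ) * (1 - Polynomial.X)).natDegree ≤ 1 := by
        compute_degree
      have h2 : (P - Polynomial.C (P.eval 0)).natDegree ≤ n + 1 := by
        rw [Polynomial.natDegree_sub_C]; omega
      refine (Polynomial.natDegree_sub_le _ _).trans (max_le (by simp) ?_)
      refine (Polynomial.natDegree_C_mul_le _ _).trans (Polynomial.natDegree_comp_le.trans ?_)
      exact (Nat.mul_le_mul h2 h1).trans (by simp)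
    have hQb : ∀ x ∈ Set.Icc (-1 : ℝ) 1, |Q.eval x| ≤ 1 := by
      rintro x ⟨hx1, hx2⟩
      have h1 : 0 ≤ P.eval ((1 - x) / 2) - P.eval 0 := by
        rw [← hint]
        exact intervalIntegral.integral_nonneg (by linarith) fun y hy =>
          hw y ⟨hy.1, hy.2.trans (by linarith)⟩
      have h2 : P.eval ((1 - x) / 2) - P.eval 0 ≤ J := by
        have h3 : 0 ≤ ∫ y in ((1 - x) / 2)..1, w.eval y :=
          intervalIntegral.integral_nonneg (by linarith) fun y hy =>
            hw y ⟨le_trans (by linarith) hy.1, hy.2⟩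
        rw [hint] at h3
        rw [hI, hint] at hIJ
        linarith
      have h4 : 2 / J * (P.eval ((1 - x) / 2) - P.eval 0) ≤ 2 := by
        rw [div_mul_eq_mul_div, div_le_iff₀ hJ]; linarith
      have h5 : 0 ≤ 2 / J * (P.eval ((1 - x) / 2) - P.eval 0) := by positivity
      rw [hQe, abs_le]
      constructor <;> linarith
    have hd : (Polynomial.derivative Q).eval 1 = w.eval 0 / J := by
      have h1 : HasDerivAt (fun x : ℝ => (1 - x) / 2) (-1 / 2) 1 := by
        simpa using ((hasDerivAt_id (1 : ℝ)).const_sub 1).div_const 2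
      have h2 : HasDerivAt (fun x => P.eval x) (w.eval 0) ((1 - (1 : ℝ)) / 2) := by
        have := P.hasDerivAt ((1 - (1 : ℝ)) / 2)
        rw [hP] at this
        simpa using this
      have h3 := (((h2.comp (1 : ℝ) h1).sub_const (P.eval 0)).const_mul (2 / J)).const_sub 1
      have h4 : (fun x => Q.eval x) = fun x => 1 - 2 / J * (P.eval ((1 - x) / 2) - P.eval 0) :=
        by funext x; exact hQe x
      have h5 := Q.hasDerivAt 1
      rw [h4] at h5
      rw [h5.unique h3]
      field_simp
    have hM := Polynomial.eval_one_derivative_le_sq hQd hQb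
    rw [hd, div_le_iff₀ hJ] at hM
    exact_mod_cast hM
  refine le_of_forall_pos_le_add fun ε hε => ?_
  have hn : 0 < ((n : ℝ) + 1) ^ 2 := by positivity
  have := key (I + ε / ((n : ℝ) + 1) ^ 2) (by positivity) (le_add_of_nonneg_right (by positivity))
  rwa [mul_add, mul_div_cancel₀ _ hn.ne'] at this

/-- The weight `1 - y` is the Duffy Jacobian; it equals `1` at `0` and keeps the integrand a
nonnegative polynomial on `[0, 1]`. Its degree is at most `2m + 1`, whence the constant `(2m + 2)² =
4 (m + 1)²`. -/
theorem Polynomial.eval_zero_sq_le_integral {m : ℕ} {p : Polynomial ℝ} (hp : p.natDegree ≤ m) :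
    p.eval 0 ^ 2 ≤ 4 * ((m : ℝ) + 1) ^ 2 * ∫ y in (0 : ℝ)..1, (1 - y) * p.eval y ^ 2 := by
  have h := Polynomial.eval_zero_le_integral (n := 2 * m + 1) (w := (1 - Polynomial.X) * p ^ 2)
    (by
      refine Polynomial.natDegree_mul_le.trans ?_
      have h1 : (1 - Polynomial.X : Polynomial ℝ).natDegree ≤ 1 := by compute_degree
      have h2 := Polynomial.natDegree_pow_le (p := p) (n := 2)
      omega)
    (fun x hx => by
      simp only [Polynomial.eval_mul, Polynomial.eval_sub, Polynomial.eval_one, Polynomial.eval_X,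
        Polynomial.eval_pow]
      exact mul_nonneg (by linarith [hx.2]) (sq_nonneg _))
  simp only [Polynomial.eval_mul, Polynomial.eval_sub, Polynomial.eval_one, Polynomial.eval_X,
    Polynomial.eval_pow, sub_zero, one_mul] at h
  refine h.trans_eq ?_
  push_cast
  ring

/-! ### Calculus of multivariate polynomials -/

theorem MvPolynomial.totalDegree_pderiv_le {σ R : Type*} [CommSemiring R] (i : σ)
    (p : MvPolynomial σ R) : (MvPolynomial.pderiv i p).totalDegree ≤ p.totalDegree - 1 := by
  conv_lhs => rw [p.as_sum, map_sum]
  refine MvPolynomial.totalDegree_finsetSum_le fun s hs => ?_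
  rw [MvPolynomial.pderiv_monomial]
  rcases Nat.eq_zero_or_pos (s i) with h0 | h0
  · simp [h0]
  · refine (MvPolynomial.totalDegree_monomial_le _ _).trans ?_
    have h1 := MvPolynomial.le_totalDegree hs
    have h2 : s.degree = (s - Finsupp.single i 1).degree + 1 := by
      have : s - Finsupp.single i 1 + Finsupp.single i 1 = s :=
        tsub_add_cancel_of_le (Finsupp.single_le_iff.2 h0)
      conv_lhs => rw [← this]
      simp
    have h3 : s.degree ≤ p.totalDegree := h1
    change (s - Finsupp.single i 1).degree ≤ _
    omega

namespace HDG

theorem hasFDerivAt_mvPolynomial (p : MvPolynomial (Fin 2) ℝ) (x : Plane) :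
    HasFDerivAt (fun y : Plane => MvPolynomial.eval (fun i => y i) p)
      (∑ i, MvPolynomial.eval (fun i => x i) (MvPolynomial.pderiv i p) •
        (EuclideanSpace.proj i : Plane →L[ℝ] ℝ)) x := by
  induction p using MvPolynomial.induction_on with
  | C a => simpa using hasFDerivAt_const a x
  | add p q hp hq =>
    simp only [map_add, add_smul, Finset.sum_add_distrib]
    exact hp.add hq
  | mul_X p i hp =>
    have hi : HasFDerivAt (fun y : Plane => y i) (EuclideanSpace.proj i : Plane →L[ℝ] ℝ) x :=
      (EuclideanSpace.proj i : Plane →L[ℝ] ℝ).hasFDerivAt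
    have h := hp.mul hi
    simp only [map_mul, MvPolynomial.eval_X]
    refine h.congr_fderiv ?_
    fin_cases i <;> ext v <;>
      simp [MvPolynomial.pderiv_X, Fin.sum_univ_two] <;> ring

/-- The restriction of a bivariate polynomial to a line is a univariate polynomial. -/
theorem exists_polynomial_line {m : ℕ} {p : MvPolynomial (Fin 2) ℝ} (hp : p.totalDegree ≤ m)
    (x v : Plane) : ∃ q : Polynomial ℝ, q.natDegree ≤ m ∧
      ∀ t : ℝ, q.eval t = MvPolynomial.eval (fun i => (x + t • v) i) p := by
  refine ⟨MvPolynomial.aeval (fun i => Polynomial.C (x i) + Polynomial.C (v i) * Polynomial.X) p,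
    ?_, fun t => ?_⟩
  · have := MvPolynomial.aeval_natDegree_le (m := m) p hp
      (fun i => Polynomial.C (x i) + Polynomial.C (v i) * Polynomial.X) (n := 1)
      (fun i => by compute_degree)
    simpa using this
  · rw [← Polynomial.coe_evalRingHom, MvPolynomial.aeval_def, MvPolynomial.hom_eval₂,
      MvPolynomial.eval, MvPolynomial.coe_eval₂Hom]
    congr 1
    · ext; simp
    · funext i
      simp only [Polynomial.coe_evalRingHom, Polynomial.eval_add, Polynomial.eval_C,
        Polynomial.eval_mul, Polynomial.eval_X, PiLp.add_apply,
        PiLp.smul_apply, smul_eq_mul, mul_comm]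

/-! ### Integrals over edges -/

theorem restrict_hausdorffMeasure_segment (a b : Plane) :
    (Measure.hausdorffMeasure 1 : Measure Plane).restrict (segment ℝ a b) =
      nndist a b • (volume.restrict (Set.Icc (0 : ℝ) 1)).map (AffineMap.lineMap a b) := by
  have hc : Continuous (AffineMap.lineMap a b : ℝ → Plane) := AffineMap.lineMap_continuous
  ext s hs
  rw [Measure.restrict_apply hs, Measure.smul_apply, Measure.map_apply hc.measurable hs,
    Measure.restrict_apply (hc.measurable hs), ← hausdorffMeasure_real,
    ← hausdorffMeasure_lineMap_image, Set.image_preimage_inter, segment_eq_image_lineMap]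

theorem facetIntegral_pair {a b : Plane} [DecidableEq Plane] (hab : a ≠ b) (f : Plane → ℝ) :
    facetIntegral {a, b} f = dist a b * ∫ s in (0 : ℝ)..1, f (a + s • (b - a)) := by
  have hc : Continuous (AffineMap.lineMap a b : ℝ → Plane) := AffineMap.lineMap_continuous
  have he : MeasurableEmbedding (AffineMap.lineMap a b : ℝ → Plane) :=
    hc.measurableEmbedding (AffineMap.lineMap_injective ℝ hab)
  rw [facetIntegral, hull, Finset.coe_pair, convexHull_pair, restrict_hausdorffMeasure_segment,
    integral_smul_nnreal_measure, he.integral_map, intervalIntegral.integral_of_le zero_le_one,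
    integral_Icc_eq_integral_Ioc]
  simp only [AffineMap.lineMap_apply, vsub_eq_sub, vadd_eq_add, add_comm, NNReal.smul_def,
    coe_nndist, smul_eq_mul]

/-! ### Integrals over triangles -/

/-- The Cartesian coordinates of the plane. -/
def ofCoords (p : ℝ × ℝ) : Plane := WithLp.toLp 2 ((MeasurableEquiv.finTwoArrow (α := ℝ)).symm p)

@[simp] theorem ofCoords_apply_zero (p : ℝ × ℝ) : ofCoords p 0 = p.1 := rfl

@[simp] theorem ofCoords_apply_one (p : ℝ × ℝ) : ofCoords p 1 = p.2 := rfl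

theorem measurePreserving_ofCoords : MeasurePreserving ofCoords volume volume :=
  (PiLp.volume_preserving_toLp (Fin 2)).comp (volume_preserving_finTwoArrow ℝ).symm

theorem measurableEmbedding_ofCoords : MeasurableEmbedding ofCoords :=
  ((MeasurableEquiv.toLp 2 (Fin 2 → ℝ)).measurableEmbedding).comp
    (MeasurableEquiv.finTwoArrow (α := ℝ)).symm.measurableEmbedding

/-- The signed area of the parallelogram spanned by two vectors. -/
def cross (v w : Plane) : ℝ := v 0 * w 1 - v 1 * w 0

theorem segment_subset_hull {a b c : Plane} [DecidableEq Plane] {s : ℝ} (hs : s ∈ Set.Icc (0 : ℝ) 1)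
    {y : ℝ} (hy : y ∈ Set.Icc (0 : ℝ) 1) :
    a + s • (b - a) + y • (c - (a + s • (b - a))) ∈ hull {a, b, c} := by
  have hcv : Convex ℝ (hull ({a, b, c} : Finset Plane)) := convex_convexHull ℝ _
  have h : ∀ x ∈ ({a, b, c} : Finset Plane), x ∈ hull ({a, b, c} : Finset Plane) := fun x hx =>
    subset_convexHull ℝ _ hx
  exact hcv.add_smul_sub_mem (hcv.add_smul_sub_mem (h a (by simp)) (h b (by simp)) hs)
    (h c (by simp)) hy

/-- Comparison of areas: the disc lies in the triangle, hence in the parallelogram spanned by two of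
its sides, so `π r² ≤ |cross|`. This turns shape regularity into a lower bound for the area and also
shows that the triangle is not degenerate. -/
theorem sq_le_abs_cross {a b c x : Plane} {r : ℝ} (hr : 0 < r) [DecidableEq Plane]
    (h : Metric.closedBall x r ⊆ hull {a, b, c}) : r ^ 2 ≤ |cross (b - a) (c - a)| := by
  let A : ℝ × ℝ → ℝ × ℝ := fun p =>
    (a 0 + ((b 0 - a 0) * p.1 + (c 0 - a 0) * p.2), a 1 + ((b 1 - a 1) * p.1 + (c 1 - a 1) * p.2))
  let A' : ℝ × ℝ →L[ℝ] ℝ × ℝ := (Matrix.toLin (.finTwoProd ℝ) (.finTwoProd ℝ)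
    !![b 0 - a 0, c 0 - a 0; b 1 - a 1, c 1 - a 1]).toContinuousLinearMap
  have hA : ∀ p, HasFDerivAt A A' p := fun p => by
    have h1 : A = fun p => (a 0, a 1) + A' p := by
      funext p
      simp [A, A', Matrix.toLin_finTwoProd_toContinuousLinearMap]
    rw [h1]
    exact A'.hasFDerivAt.const_add _
  have hdet : A'.det = cross (b - a) (c - a) := by
    simp only [A', LinearMap.det_toContinuousLinearMap, LinearMap.det_toLin,
      Matrix.det_fin_two_of, cross, PiLp.sub_apply]
    ring
  have hsub : hull {a, b, c} ⊆ ofCoords '' (A '' (Set.Icc (0 : ℝ) 1 ×ˢ Set.Icc (0 : ℝ) 1)) := by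
    intro z hz
    simp only [hull, Finset.coe_insert, Finset.coe_singleton] at hz
    rw [convexHull_insert (by simp), convexHull_pair] at hz
    simp only [convexJoin_singleton_left, Set.mem_iUnion, exists_prop] at hz
    obtain ⟨w, ⟨α, β, hα, hβ, hαβ, rfl⟩, ⟨γ, δ, hγ, hδ, hγδ, rfl⟩⟩ := hz
    refine ⟨_, ⟨(δ * α, δ * β), ⟨⟨by positivity, ?_⟩, ⟨by positivity, ?_⟩⟩, rfl⟩, ?_⟩
    · show δ * α ≤ 1; nlinarith
    · show δ * β ≤ 1; nlinarith
    · obtain rfl : α = 1 - β := by linarith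
      obtain rfl : γ = 1 - δ := by linarith
      ext i
      fin_cases i <;> simp [A] <;> ring
  have hvol : volume (Metric.closedBall x r) ≤ ENNReal.ofReal |cross (b - a) (c - a)| := by
    refine (measure_mono (h.trans hsub)).trans ?_
    have h1 := addHaar_image_le_lintegral_abs_det_fderiv (volume : Measure (ℝ × ℝ))
      (s := Set.Icc (0 : ℝ) 1 ×ˢ Set.Icc (0 : ℝ) 1) (f := A) (f' := fun _ => A')
      (measurableSet_Icc.prod measurableSet_Icc) fun p _ => (hA p).hasFDerivWithinAt
    rw [← measurePreserving_ofCoords.measure_preimage_emb measurableEmbedding_ofCoords,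
      Set.preimage_image_eq _ measurableEmbedding_ofCoords.injective]
    refine h1.trans_eq ?_
    rw [hdet, setLIntegral_const, Measure.volume_eq_prod, Measure.prod_prod]
    simp
  rw [EuclideanSpace.volume_closedBall_fin_two, ← ENNReal.ofReal_pow hr.le,
    ← ENNReal.ofReal_mul (by positivity), ENNReal.ofReal_le_ofReal_iff (abs_nonneg _)] at hvol
  nlinarith [Real.pi_gt_three, sq_nonneg r]

/-- Integration over a triangle in collapsed (Duffy) coordinates. -/
theorem abs_cross_mul_integral_le {a b c : Plane} [DecidableEq Plane]
    (hD : cross (b - a) (c - a) ≠ 0) {f : Plane → ℝ} (hf : Continuous f) (hf0 : ∀ x, 0 ≤ f x) :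
    |cross (b - a) (c - a)| * ∫ s in (0 : ℝ)..1, ∫ y in (0 : ℝ)..1,
      (1 - y) * f (a + s • (b - a) + y • (c - (a + s • (b - a)))) ≤ ∫ x in hull {a, b, c}, f x := by
  let Q : Set (ℝ × ℝ) := Set.Ioo (0 : ℝ) 1 ×ˢ Set.Ioo (0 : ℝ) 1
  have hQ : MeasurableSet Q := measurableSet_Ioo.prod measurableSet_Ioo
  -- The first coordinate runs along the edge from `a` to `b`, the second along the segment from
  -- that point to `c`. The side `y = 1` collapses to `c`, so injectivity requires the open square.
  -- For the inequality, the image only has to lie inside the triangle.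
  let A : ℝ × ℝ → ℝ × ℝ := fun p =>
    (a 0 + p.1 * (b 0 - a 0) + p.2 * (c 0 - (a 0 + p.1 * (b 0 - a 0))),
      a 1 + p.1 * (b 1 - a 1) + p.2 * (c 1 - (a 1 + p.1 * (b 1 - a 1))))
  let A' : ℝ × ℝ → ℝ × ℝ →L[ℝ] ℝ × ℝ := fun p => (Matrix.toLin (.finTwoProd ℝ) (.finTwoProd ℝ)
    !![(1 - p.2) * (b 0 - a 0), c 0 - (a 0 + p.1 * (b 0 - a 0));
      (1 - p.2) * (b 1 - a 1), c 1 - (a 1 + p.1 * (b 1 - a 1))]).toContinuousLinearMap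
  have hco : ∀ (α β γ : ℝ) (p : ℝ × ℝ), HasFDerivAt
      (fun p : ℝ × ℝ => α + p.1 * (β - α) + p.2 * (γ - (α + p.1 * (β - α))))
      (((1 - p.2) * (β - α)) • ContinuousLinearMap.fst ℝ ℝ ℝ +
        (γ - (α + p.1 * (β - α))) • ContinuousLinearMap.snd ℝ ℝ ℝ) p := fun α β γ p => by
    have h1 : HasFDerivAt (fun p : ℝ × ℝ => α + p.1 * (β - α)) _ p :=
      ((hasFDerivAt_fst (𝕜 := ℝ)).mul_const (β - α)).const_add α
    have h2 := h1.add ((hasFDerivAt_snd (𝕜 := ℝ) (p := p)).mul (h1.const_sub γ))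
    refine h2.congr_fderiv ?_
    ext
    · simp
      ring
    · simp
  have hA : ∀ p, HasFDerivAt A (A' p) p := fun p => by
    simp only [A', Matrix.toLin_finTwoProd_toContinuousLinearMap]
    exact (hco _ _ _ p).prodMk (hco _ _ _ p)
  have hdet : ∀ p, (A' p).det = (1 - p.2) * cross (b - a) (c - a) := fun p => by
    simp only [A', LinearMap.det_toContinuousLinearMap, LinearMap.det_toLin,
      Matrix.det_fin_two_of, cross, PiLp.sub_apply]
    ring
  have hAe : ∀ p, ofCoords (A p) = a + p.1 • (b - a) + p.2 • (c - (a + p.1 • (b - a))) := fun p => by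
    ext i
    fin_cases i <;> simp [A]
  have hinj : Set.InjOn A Q := by
    rintro ⟨s, y⟩ ⟨-, hy⟩ ⟨s', y'⟩ ⟨-, hy'⟩ h
    simp only [A, Prod.mk.injEq] at h hy hy' ⊢
    obtain ⟨h0, h1⟩ := h
    simp only [cross, PiLp.sub_apply] at hD
    have hyy : y = y' := by
      have : (y - y') * ((b 0 - a 0) * (c 1 - a 1) - (b 1 - a 1) * (c 0 - a 0)) = 0 := by
        linear_combination (b 0 - a 0) * h1 - (b 1 - a 1) * h0
      exact sub_eq_zero.1 ((mul_eq_zero.1 this).resolve_right hD)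
    subst hyy
    have : (s - s') * (1 - y) * ((b 0 - a 0) * (c 1 - a 1) - (b 1 - a 1) * (c 0 - a 0)) = 0 := by
      linear_combination (c 1 - a 1) * h0 - (c 0 - a 0) * h1
    have h2 := (mul_eq_zero.1 this).resolve_right hD
    have h3 := (mul_eq_zero.1 h2).resolve_right (by linarith [hy.2] : 1 - y ≠ 0)
    exact ⟨sub_eq_zero.1 h3, rfl⟩
  have hsub : ofCoords '' (A '' Q) ⊆ hull {a, b, c} := by
    rintro _ ⟨_, ⟨p, ⟨hs, hy⟩, rfl⟩, rfl⟩
    rw [hAe]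
    exact segment_subset_hull (Set.Ioo_subset_Icc_self hs) (Set.Ioo_subset_Icc_self hy)
  have hcpt : IsCompact (hull ({a, b, c} : Finset Plane)) := Finset.finite_toSet _ |>.isCompact_convexHull ℝ
  have h1 : ∫ x in ofCoords '' (A '' Q), f x ≤ ∫ x in hull {a, b, c}, f x :=
    setIntegral_mono_set (hf.continuousOn.integrableOn_compact hcpt)
      (Filter.Eventually.of_forall hf0) (Filter.Eventually.of_forall hsub)
  refine le_trans (le_of_eq ?_) h1
  let G : ℝ × ℝ → ℝ := fun p => |cross (b - a) (c - a)| *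
    ((1 - p.2) * f (a + p.1 • (b - a) + p.2 • (c - (a + p.1 • (b - a)))))
  have hG : Continuous G := by fun_prop
  rw [measurePreserving_ofCoords.setIntegral_image_emb measurableEmbedding_ofCoords,
    integral_image_eq_integral_abs_det_fderiv_smul volume hQ
      (fun p _ => (hA p).hasFDerivWithinAt) hinj]
  have h2 : ∫ p in Q, |(A' p).det| • f (ofCoords (A p)) = ∫ p in Q, G p := by
    refine setIntegral_congr_fun hQ fun p hp => ?_
    have : 0 ≤ 1 - p.2 := by linarith [hp.2.2]
    simp only [hdet, hAe, G, abs_mul, abs_of_nonneg this, smul_eq_mul]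
    ring
  rw [h2, Measure.volume_eq_prod, setIntegral_prod G]
  · rw [← intervalIntegral.integral_const_mul, intervalIntegral.integral_of_le zero_le_one,
      integral_Ioc_eq_integral_Ioo]
    refine setIntegral_congr_fun measurableSet_Ioo fun s _ => ?_
    simp only [G]
    rw [integral_const_mul, intervalIntegral.integral_of_le zero_le_one,
      integral_Ioc_eq_integral_Ioo]
  · exact (hG.continuousOn.integrableOn_compact (isCompact_Icc.prod isCompact_Icc)).mono_set
      (Set.prod_mono Set.Ioo_subset_Icc_self Set.Ioo_subset_Icc_self)

/-- The discrete trace inequality on a triangle, explicit in the polynomial degree. -/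
theorem facetIntegral_sq_le {a b c : Plane} [DecidableEq Plane] (hab : a ≠ b)
    (hD : cross (b - a) (c - a) ≠ 0) {m : ℕ} {p : MvPolynomial (Fin 2) ℝ} (hp : p.totalDegree ≤ m) :
    facetIntegral {a, b} (fun x => MvPolynomial.eval (fun i => x i) p ^ 2) ≤
      4 * ((m : ℝ) + 1) ^ 2 * (dist a b / |cross (b - a) (c - a)|) *
        ∫ x in hull {a, b, c}, MvPolynomial.eval (fun i => x i) p ^ 2 := by
  have hc : Continuous fun x : Plane => MvPolynomial.eval (fun i => x i) p ^ 2 :=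
    ((MvPolynomial.continuous_eval p).comp (by fun_prop)).pow 2
  set f : Plane → ℝ := fun x => MvPolynomial.eval (fun i => x i) p ^ 2 with hf
  have h1 := abs_cross_mul_integral_le hD hc fun x => sq_nonneg _
  have hpos : 0 < |cross (b - a) (c - a)| := abs_pos.2 hD
  rw [mul_comm, ← le_div_iff₀ hpos] at h1
  have h2 : ∫ s in (0 : ℝ)..1, f (a + s • (b - a)) ≤ ∫ s in (0 : ℝ)..1, 4 * ((m : ℝ) + 1) ^ 2 *
      ∫ y in (0 : ℝ)..1, (1 - y) * f (a + s • (b - a) + y • (c - (a + s • (b - a)))) := by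
    refine intervalIntegral.integral_mono_on zero_le_one
      (Continuous.intervalIntegrable (by fun_prop) _ _)
      (Continuous.intervalIntegrable (continuous_const.mul
        (intervalIntegral.continuous_parametric_intervalIntegral_of_continuous' (by fun_prop) _ _)) _ _)
      fun s _ => ?_
    -- For fixed `s`, the univariate inequality applies on the segment from the edge point to the
    -- opposite vertex.
    obtain ⟨q, hqd, hq⟩ := exists_polynomial_line hp (a + s • (b - a)) (c - (a + s • (b - a)))
    have h3 := Polynomial.eval_zero_sq_le_integral hqd
    simp only [hq, zero_smul, add_zero] at h3
    exact h3
  rw [intervalIntegral.integral_const_mul] at h2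
  rw [facetIntegral_pair hab]
  calc dist a b * ∫ s in (0 : ℝ)..1, f (a + s • (b - a))
      ≤ dist a b * (4 * ((m : ℝ) + 1) ^ 2 *
        ((∫ x in hull {a, b, c}, f x) / |cross (b - a) (c - a)|)) := by
        refine mul_le_mul_of_nonneg_left (h2.trans ?_) dist_nonneg
        exact mul_le_mul_of_nonneg_left h1 (by positivity)
    _ = _ := by ring

/-! ### The trace inequality on shape regular triangles -/

theorem isCompact_hull (s : Finset Plane) : IsCompact (hull s) :=
  s.finite_toSet.isCompact_convexHull ℝ

theorem hull_mono {s t : Finset Plane} (h : s ⊆ t) : hull s ⊆ hull t :=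
  convexHull_mono (by exact_mod_cast h)

theorem integrableOn_facet {F : Finset Plane} (hF : F.card = 2) {f : Plane → ℝ}
    (hf : ContinuousOn f (hull F)) : IntegrableOn f (hull F) (Measure.hausdorffMeasure 1) := by
  have := isFiniteMeasure_facet hF
  have hms : MeasurableSet (hull F) := (isCompact_hull F).isClosed.measurableSet
  obtain ⟨C, hC⟩ := (isCompact_hull F).exists_bound_of_continuousOn hf
  exact Integrable.of_bound (hf.aestronglyMeasurable hms) C
    ((ae_restrict_iff' hms).2 (Filter.Eventually.of_forall hC))

theorem continuous_mvPolynomial (p : MvPolynomial (Fin 2) ℝ) :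
    Continuous fun x : Plane => MvPolynomial.eval (fun i => x i) p :=
  (MvPolynomial.continuous_eval p).comp (by fun_prop)

/-- Both the edge length and `h / κ` are at most `σ r`, while twice the area is at least `r²`. Hence
the ratio of edge length to twice the area is at most `σ² κ / h`. -/
theorem facetIntegral_sq_le_of_shapeRegular {T F : Finset Plane} (hT : T.card = 3)
    (hF : F ∈ edges T) {x : Plane} {r σ κ h : ℝ} (hr : 0 < r)
    (hball : Metric.closedBall x r ⊆ hull T) (hσ : Metric.diam (hull T) ≤ σ * r) (hh : 0 < h)
    (hκ : h ≤ κ * Metric.diam (hull T)) {m : ℕ} {p : MvPolynomial (Fin 2) ℝ}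
    (hp : p.totalDegree ≤ m) :
    facetIntegral F (fun x => MvPolynomial.eval (fun i => x i) p ^ 2) ≤
      4 * σ ^ 2 * κ * (((m : ℝ) + 1) ^ 2 / h) *
        ∫ x in hull T, MvPolynomial.eval (fun i => x i) p ^ 2 := by
  classical
  obtain ⟨hFT, hFc⟩ := Finset.mem_powersetCard.1 hF
  obtain ⟨c, hc⟩ : ∃ c, T \ F = {c} := Finset.card_eq_one.1 (by
    rw [Finset.card_sdiff_of_subset hFT]; omega)
  obtain ⟨a, b, hab, rfl⟩ := Finset.card_eq_two.1 hFc
  obtain rfl : T = {a, b, c} := by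
    rw [← Finset.sdiff_union_of_subset hFT, hc]
    ext; simp; tauto
  have hD := sq_le_abs_cross hr hball
  have hD0 : 0 < |cross (b - a) (c - a)| := lt_of_lt_of_le (by positivity) hD
  have hmem : ∀ y ∈ ({a, b, c} : Finset Plane), y ∈ hull ({a, b, c} : Finset Plane) :=
    fun y hy => subset_convexHull ℝ _ hy
  have hd : dist a b ≤ Metric.diam (hull ({a, b, c} : Finset Plane)) :=
    Metric.dist_le_diam_of_mem (isCompact_hull _).isBounded (hmem a (by simp)) (hmem b (by simp))
  have hab0 : 0 < dist a b := dist_pos.2 hab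
  set d := Metric.diam (hull ({a, b, c} : Finset Plane))
  have hd0 : 0 < d := hab0.trans_le hd
  have hκ0 : 0 < κ := pos_of_mul_pos_left (hh.trans_le hκ) hd0.le
  refine (facetIntegral_sq_le hab (abs_pos.1 hD0) hp).trans ?_
  refine mul_le_mul_of_nonneg_right ?_ (integral_nonneg fun _ => sq_nonneg _)
  have hkey : dist a b / |cross (b - a) (c - a)| ≤ σ ^ 2 * κ / h := by
    rw [div_le_div_iff₀ hD0 hh]
    calc dist a b * h ≤ (σ * r) * (κ * (σ * r)) := by
          refine mul_le_mul (hd.trans hσ) (hκ.trans ?_) hh.le (hd0.le.trans hσ)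
          exact mul_le_mul_of_nonneg_left hσ hκ0.le
      _ = σ ^ 2 * κ * r ^ 2 := by ring
      _ ≤ _ := mul_le_mul_of_nonneg_left hD (by positivity)
  calc 4 * ((m : ℝ) + 1) ^ 2 * (dist a b / |cross (b - a) (c - a)|)
      ≤ 4 * ((m : ℝ) + 1) ^ 2 * (σ ^ 2 * κ / h) := mul_le_mul_of_nonneg_left hkey (by positivity)
    _ = _ := by ring

/-! ### The gradient of a discrete velocity -/

/-- A nonempty interior makes derivatives within the closed triangle unique, even at boundary
points, so `fderivWithin` agrees there with the polynomial Jacobian. The degree drop to `k - 1` is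
what later gives the factor `k²` instead of `(k + 1)²`. -/
theorem exists_eltDeriv_eq {k : ℕ} {T : Finset Plane} {u : Velocity}
    (hu : IsVecPolyOn k (hull T) (u.elt T)) (hT : (interior (hull T)).Nonempty) :
    ∃ g : Fin 2 → Fin 2 → MvPolynomial (Fin 2) ℝ, (∀ i j, (g i j).totalDegree ≤ k - 1) ∧
      ∀ x ∈ hull T, ∀ v i, eltDeriv u T x v i =
        ∑ j, MvPolynomial.eval (fun l => x l) (g i j) * v j := by
  choose p hpd hp using hu
  refine ⟨fun i j => MvPolynomial.pderiv j (p i), fun i j =>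
    (MvPolynomial.totalDegree_pderiv_le _ _).trans (Nat.sub_le_sub_right (hpd i) 1),
    fun x hx v i => ?_⟩
  have huniq : UniqueDiffWithinAt ℝ (hull T) x := uniqueDiffOn_convex (convex_convexHull ℝ _) hT x hx
  let L : Plane →L[ℝ] Plane := (EuclideanSpace.equiv (Fin 2) ℝ).symm.toContinuousLinearMap.comp
    (ContinuousLinearMap.pi fun i => ∑ j, MvPolynomial.eval (fun l => x l)
      (MvPolynomial.pderiv j (p i)) • (EuclideanSpace.proj j : Plane →L[ℝ] ℝ))
  have hL : HasFDerivWithinAt (u.elt T) L (hull T) x := by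
    rw [hasFDerivWithinAt_euclidean]
    intro i
    exact (hasFDerivAt_mvPolynomial (p i) x).hasFDerivWithinAt.congr (hp i) (hp i x hx)
  rw [eltDeriv, hL.fderivWithin huniq]
  simp [L]

/-- The upper bound also covers the convention `0⁻¹ = 0`, so no nondegeneracy of the edge and the
triangle has to be checked. -/
theorem norm_outwardNormal_le (T F : Finset Plane) : ‖outwardNormal T F‖ ≤ 1 := by
  simp only [outwardNormal, norm_smul, norm_inv, norm_norm]
  exact inv_mul_le_one

theorem gradDot_self_eq {u : Velocity} {T : Finset Plane} {x : Plane} {A : Fin 2 → Fin 2 → ℝ}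
    (h : ∀ v i, eltDeriv u T x v i = ∑ j, A i j * v j) :
    gradDot u u T x = ∑ i, ∑ j, A i j ^ 2 := by
  rw [gradDot, Finset.sum_comm]
  refine Finset.sum_congr rfl fun j _ => ?_
  rw [real_inner_self_eq_norm_sq, EuclideanSpace.real_norm_sq_eq]
  refine Finset.sum_congr rfl fun i _ => ?_
  rw [h]
  simp

/-- By Cauchy–Schwarz, the normal derivative is dominated by the Frobenius norm of the gradient,
whose entries are polynomials to which the scalar trace inequality applies. -/
theorem norm_normalDeriv_sq_le {u : Velocity} {T : Finset Plane} (F : Finset Plane) {x : Plane}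
    {A : Fin 2 → Fin 2 → ℝ} (h : ∀ v i, eltDeriv u T x v i = ∑ j, A i j * v j) :
    ‖normalDeriv u T F x‖ ^ 2 ≤ ∑ i, ∑ j, A i j ^ 2 := by
  rw [EuclideanSpace.real_norm_sq_eq]
  refine Finset.sum_le_sum fun i _ => ?_
  rw [normalDeriv, h]
  refine (Finset.sum_mul_sq_le_sq_mul_sq _ _ _).trans ?_
  rw [← EuclideanSpace.real_norm_sq_eq]
  exact mul_le_of_le_one_right (Finset.sum_nonneg fun _ _ => sq_nonneg _)
    (pow_le_one₀ (norm_nonneg _) (norm_outwardNormal_le T F))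

/-! ### The projected jump -/

theorem IsPolyOn.continuousOn {m : ℕ} {S : Set Plane} {f : Plane → ℝ} (hf : IsPolyOn m S f) :
    ContinuousOn f S := by
  obtain ⟨p, -, hp⟩ := hf
  exact (continuous_mvPolynomial p).continuousOn.congr hp

theorem IsVecPolyOn.continuousOn {m : ℕ} {S : Set Plane} {f : Plane → Plane}
    (hf : IsVecPolyOn m S f) : ContinuousOn f S := by
  have h : ContinuousOn (fun x i => f x i) S := continuousOn_pi.2 fun i => (hf i).continuousOn
  exact (PiLp.continuous_toLp 2 _).comp_continuousOn h

/-- Continuity of the unprojected jump guarantees that the projection exists. The chosen `facetProj`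
is then a polynomial on the facet, which gives the integrability needed for Young's inequality. -/
theorem continuousOn_projJump {k l m : ℕ} {u : Velocity} {T F : Finset Plane} (hF : F ∈ edges T)
    (he : IsVecPolyOn l (hull T) (u.elt T)) (hf : IsVecPolyOn m (hull F) (u.fct F)) :
    ContinuousOn (projJump k u T F) (hull F) := by
  obtain ⟨hFT, hFc⟩ := Finset.mem_powersetCard.1 hF
  have h1 : ContinuousOn (tangentialJump u T F) (hull F) := by
    have h2 := he.continuousOn.mono (hull_mono hFT)
    have h3 : ContinuousOn (fun x => ⟪u.elt T x, outwardNormal T F⟫) (hull F) :=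
      h2.inner continuousOn_const
    have h4 : ContinuousOn (fun x => ⟪u.elt T x, outwardNormal T F⟫ • outwardNormal T F) (hull F) :=
      h3.smul continuousOn_const
    exact (h2.sub h4).sub hf.continuousOn
  refine IsVecPolyOn.continuousOn (m := k - 1) fun i => ?_
  exact (facetProj_spec (k - 1) hFc
    ((EuclideanSpace.proj i : Plane →L[ℝ] ℝ).continuous.comp_continuousOn h1)).1

/-! ### Coercivity on one triangle -/

theorem two_mul_inner_le {E : Type*} [NormedAddCommGroup E] [InnerProductSpace ℝ E] (x y : E)
    {δ : ℝ} (hδ : 0 < δ) : 2 * ⟪x, y⟫ ≤ δ * ‖x‖ ^ 2 + δ⁻¹ * ‖y‖ ^ 2 := by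
  have h1 := real_inner_le_norm x y
  have h2 : δ * ‖x‖ ^ 2 + δ⁻¹ * ‖y‖ ^ 2 - 2 * (‖x‖ * ‖y‖) = δ⁻¹ * (δ * ‖x‖ - ‖y‖) ^ 2 := by
    field_simp; ring
  have h3 : 0 ≤ δ⁻¹ * (δ * ‖x‖ - ‖y‖) ^ 2 := by positivity
  linarith

/-- Young's inequality for the consistency term, combined with the trace inequality. -/
theorem two_mul_facetIntegral_inner_le {k : ℕ} (hk : 1 ≤ k) {T F : Finset Plane} (hT : T.card = 3)
    (hF : F ∈ edges T) {x₀ : Plane} {r σ κ h C : ℝ} (hr : 0 < r)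
    (hball : Metric.closedBall x₀ r ⊆ hull T) (hσ : Metric.diam (hull T) ≤ σ * r) (hh : 0 < h)
    (hκ : h ≤ κ * Metric.diam (hull T)) (hC : 4 * σ ^ 2 * κ ≤ C) (hC0 : 0 < C) {u : Velocity}
    (he : IsVecPolyOn k (hull T) (u.elt T)) (hf : IsVecPolyOn (k - 1) (hull F) (u.fct F)) :
    2 * facetIntegral F (fun x => ⟪normalDeriv u T F x, projJump k u T F x⟫) ≤
      1 / 6 * (∫ x in hull T, gradDot u u T x) +
        6 * C * ((k : ℝ) ^ 2 / h * facetIntegral F fun x => ‖projJump k u T F x‖ ^ 2) := by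
  obtain ⟨hFT, hFc⟩ := Finset.mem_powersetCard.1 hF
  have hFT' := hull_mono hFT
  have hint : (interior (hull T)).Nonempty := ⟨x₀, mem_interior.2
    ⟨_, Metric.ball_subset_closedBall.trans hball, Metric.isOpen_ball, Metric.mem_ball_self hr⟩⟩
  obtain ⟨g, hgd, hg⟩ := exists_eltDeriv_eq he hint
  have hk0 : 0 < (k : ℝ) := by exact_mod_cast hk
  have hms : ∀ s : Finset Plane, MeasurableSet (hull s) := fun s =>
    (isCompact_hull s).isClosed.measurableSet
  let e : Fin 2 → Fin 2 → Plane → ℝ := fun i j x => MvPolynomial.eval (fun l => x l) (g i j)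
  have hec : ∀ i j, Continuous (e i j) := fun i j => continuous_mvPolynomial _
  have hes : ∀ i j, Continuous fun x => e i j x ^ 2 := fun i j => (hec i j).pow 2
  let S : Plane → ℝ := fun x => ∑ i, ∑ j, e i j x ^ 2
  have hSc : Continuous S := continuous_finsetSum _ fun i _ => continuous_finsetSum _ fun j _ =>
    hes i j
  have hG : ∫ x in hull T, gradDot u u T x = ∑ i, ∑ j, ∫ x in hull T, e i j x ^ 2 := by
    rw [setIntegral_congr_fun (hms T) fun x hx => gradDot_self_eq (hg x hx)]
    have hi : ∀ i j, IntegrableOn (fun x => e i j x ^ 2) (hull T) volume := fun i j =>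
      (hes i j).continuousOn.integrableOn_compact (isCompact_hull T)
    rw [integral_finsetSum _ fun i _ => integrable_finsetSum _ fun j _ => hi i j]
    exact Finset.sum_congr rfl fun i _ => integral_finsetSum _ fun j _ => hi i j
  have hS : facetIntegral F S ≤ C * ((k : ℝ) ^ 2 / h) * ∫ x in hull T, gradDot u u T x := by
    have hi : ∀ i j, IntegrableOn (fun x => e i j x ^ 2) (hull F) (Measure.hausdorffMeasure 1) :=
      fun i j => integrableOn_facet hFc (hes i j).continuousOn
    have h1 : facetIntegral F S = ∑ i, ∑ j, facetIntegral F fun x => e i j x ^ 2 := by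
      unfold facetIntegral
      rw [integral_finsetSum _ fun i _ => integrable_finsetSum _ fun j _ => hi i j]
      exact Finset.sum_congr rfl fun i _ => integral_finsetSum _ fun j _ => hi i j
    rw [h1, hG, Finset.mul_sum]
    refine Finset.sum_le_sum fun i _ => ?_
    rw [Finset.mul_sum]
    refine Finset.sum_le_sum fun j _ => ?_
    have h2 := facetIntegral_sq_le_of_shapeRegular hT hF hr hball hσ hh hκ (hgd i j)
    have h3 : ((k - 1 : ℕ) : ℝ) + 1 = k := by exact_mod_cast Nat.sub_add_cancel hk
    rw [h3] at h2
    refine h2.trans (mul_le_mul_of_nonneg_right ?_ (integral_nonneg fun _ => sq_nonneg _))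
    exact mul_le_mul_of_nonneg_right hC (by positivity)
  have hJ := continuousOn_projJump (k := k) hF he hf
  have hN : ContinuousOn (normalDeriv u T F) (hull F) := by
    have h1 : ContinuousOn (fun x i => normalDeriv u T F x i) (hull F) :=
      continuousOn_pi.2 fun i => by
        refine ContinuousOn.congr (f := fun x => ∑ j, e i j x * outwardNormal T F j) ?_
          fun x hx => hg x (hFT' hx) _ i
        exact (continuous_finsetSum _ fun j _ => (hec i j).mul continuous_const).continuousOn
    exact (PiLp.continuous_toLp 2 _).comp_continuousOn h1
  -- This weight cancels the trace constant `C k² / h` and leaves exactly one sixth of the gradient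
  -- energy for each edge.
  set δ : ℝ := (6 * C * ((k : ℝ) ^ 2 / h))⁻¹ with hδ
  have hδ0 : 0 < δ := by positivity
  have hY : 2 * facetIntegral F (fun x => ⟪normalDeriv u T F x, projJump k u T F x⟫) ≤
      δ * facetIntegral F S + δ⁻¹ * facetIntegral F fun x => ‖projJump k u T F x‖ ^ 2 := by
    unfold facetIntegral
    have i1 := (integrableOn_facet hFc hSc.continuousOn).const_mul δ
    have i2 := (integrableOn_facet (f := fun x => ‖projJump k u T F x‖ ^ 2) hFc
      (hJ.norm.pow 2)).const_mul δ⁻¹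
    rw [← integral_const_mul, ← integral_const_mul, ← integral_const_mul, ← integral_add i1 i2]
    refine setIntegral_mono_on ((integrableOn_facet hFc (hN.inner hJ)).const_mul 2) (i1.add i2)
      (hms F) fun x hx => ?_
    refine (two_mul_inner_le _ _ hδ0).trans ?_
    gcongr
    exact norm_normalDeriv_sq_le F (hg x (hFT' hx))
  refine hY.trans ?_
  have h4 : δ * (C * ((k : ℝ) ^ 2 / h) * ∫ x in hull T, gradDot u u T x) =
      1 / 6 * ∫ x in hull T, gradDot u u T x := by
    rw [hδ]; field_simp
  have h5 : δ⁻¹ = 6 * C * ((k : ℝ) ^ 2 / h) := by rw [hδ, inv_inv]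
  have h6 := mul_le_mul_of_nonneg_left hS hδ0.le
  rw [h4] at h6
  rw [h5, mul_assoc (6 * C)]
  linarith

end HDG

/-! ### Coercivity by summation over the triangles -/

theorem mainTheorem5 (σ κ : ℝ) :
    ∃ lam : ℝ, 0 < lam ∧ ∃ c : ℝ, 0 < c ∧
      ∀ (Ω : Set HDG.Plane) (_ : IsOpen Ω) (𝒯 : HDG.Triangulation Ω) (_ : 𝒯.ShapeRegular σ)
        (h : Finset HDG.Plane → ℝ) (_ : 𝒯.IsMeshSize κ h) (k : ℕ) (_ : 1 ≤ k) (ν : ℝ) (_ : 0 < ν)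
        (u : HDG.Velocity) (_ : HDG.IsDiscreteVelocity 𝒯 k u),
        c * ν * HDG.energyNorm 𝒯 k h u ^ 2 ≤ HDG.bilinA 𝒯 ν lam k h u u := by
  -- The maximum with `1` keeps `C` positive for arbitrary real `σ` and `κ`.
  obtain ⟨C, hC, hC0⟩ : ∃ C : ℝ, 4 * σ ^ 2 * κ ≤ C ∧ 0 < C :=
    ⟨max (4 * σ ^ 2 * κ) 1, le_max_left _ _, lt_max_of_lt_right one_pos⟩
  -- Young's inequality costs `6 C` of the stabilization and, over three edges, `3 · 1/6 = 1/2` of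
  -- the gradient energy. With this choice of `λ`, one half of each term of the norm remains.
  refine ⟨6 * C + 1 / 2, by positivity, 1 / 2, by norm_num, ?_⟩
  intro Ω _ 𝒯 hσ h hh k hk ν hν u hu
  have hJ0 : ∀ T F, 0 ≤ HDG.facetIntegral F fun x => ‖HDG.projJump k u T F x‖ ^ 2 := fun T F =>
    integral_nonneg fun _ => by positivity
  have hG0 : ∀ T, 0 ≤ ∫ x in HDG.hull T, HDG.gradDot u u T x := fun T =>
    integral_nonneg fun x => Finset.sum_nonneg fun j _ => real_inner_self_nonneg
  rw [HDG.energyNorm, Real.sq_sqrt (Finset.sum_nonneg fun T hT => add_nonneg (hG0 T)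
    (mul_nonneg (div_nonneg (by positivity) (hh T hT).1.le) (Finset.sum_nonneg fun F _ => hJ0 T F))),
    HDG.bilinA, Finset.mul_sum]
  refine Finset.sum_le_sum fun T hT => ?_
  obtain ⟨hTf, hTc⟩ := Finset.mem_filter.1 hT
  obtain ⟨x₀, r, hr, hball, hd⟩ := hσ T hT
  obtain ⟨hh0, -, hκ⟩ := hh T hT
  have hfacet : ∀ F ∈ HDG.edges T, F ∈ 𝒯.facets := fun F hF => by
    obtain ⟨hFT, hFc⟩ := Finset.mem_powersetCard.1 hF
    refine Finset.mem_filter.2 ⟨?_, hFc⟩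
    rw [Set.Finite.mem_toFinset] at hTf ⊢
    exact 𝒯.down_closed hTf hFT (Finset.card_pos.1 (by omega))
  have hsum := Finset.sum_le_sum fun F hF => HDG.two_mul_facetIntegral_inner_le hk hTc hF hr hball
    hd hh0 hκ hC hC0 (hu.elt_poly T hT) (hu.fct_poly F (hfacet F hF))
  have hcard : (HDG.edges T).card = 3 := by
    rw [HDG.edges, Finset.card_powersetCard, hTc]; rfl
  rw [Finset.sum_add_distrib, Finset.sum_const, hcard, ← Finset.mul_sum, ← Finset.mul_sum,
    ← Finset.mul_sum] at hsum
  simp only [HDG.facetIntegral, integral_const_mul, real_inner_self_eq_norm_sq, ← Finset.mul_sum]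
    at hsum ⊢
  simp only [nsmul_eq_mul, Nat.cast_ofNat] at hsum
  have := mul_le_mul_of_nonneg_left hsum hν.le
  linear_combination this
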